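/- Let $F$ be a field, $n\ge 0$ an integer and $q\in F$ with $q\neq 0$. Let $F(x)=F(x_1,\dots,x_n)$ be the field of rational functions, with its partial derivatives $\partial_1,\dots,\partial_n$, acting together with the multiplications by elements of $F(x)$ as $F$-linear operators on $F(x)$. For $r\in\mathbb N^n$ put $|r|=r_1+\cdots+r_n$ and $\partial^r=\partial_1^{r_1}\cdots\partial_n^{r_n}$. A differential operator of order $d$ with coefficients in $F(x)$ is an operator of the form $D=\sum_{|r|\le d}a_r(x)\,\partial^r$ with $a_r\in F(x)$ and $a_r\ne 0$ for at least one $r$ with $|r|=d$. For $k\ge 1$ let $$D_{k;q}=\sum_{i=1}^n\bigl(q\,x_i\,\partial_i^{k+1}+\partial_i^k\bigr).$$ In the polynomial ring $F(x)[\xi]=F(x)[\xi_1,\dots,\xi_n]$ let $\varphi_m(\xi)=\sum_{i=1}^n x_i\,\xi_i^m$ and let $\Phi_n^2$ be the ideal generated by $\varphi_2,\varphi_3,\dots,\varphi_{n+1}$. Then the $F(x)$-vector space $F(x)[\xi]/\Phi_n^2$ has a basis consisting of (the classes of) $(n+1)!$ monomials in $\xi$. Moreover, let $u_1,\dots,u_{(n+1)!}$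 be any monomials in $\xi$ whose classes form such a basis, and put $d_i=\deg u_i$. Then, for every $d\ge 0$, every differential operator $D$ of order $d$ with coefficients in $F(x)$ has an expansion $$D=\sum_{i=1}^{(n+1)!}\ \sum_{\substack{r\in\mathbb N^n\\ \sum_{k=1}^n r_k(k+1)\le d-d_i}} a_{i;r}(x)\;u_i(\partial)\;D_{1;q}^{r_1}D_{2;q}^{r_2}\cdots D_{n;q}^{r_n},\qquad a_{i;r}(x)\in F(x),$$ where $u_i(\partial)$ is the operator obtained from $u_i(\xi)$ by substituting $\partial_j$ for $\xi_j$. -/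

import Mathlib

noncomputable section

namespace Steenrod

open MvPolynomial

/-- The field `F(x) = F(x_1, …, x_n)` of rational functions in `n` variables. -/
abbrev RatFun (F : Type*) [Field F] (n : ℕ) : Type _ :=
  FractionRing (MvPolynomial (Fin n) F)

variable {F : Type*} [Field F] {n : ℕ}

/-- The variable `x_i`, as an element of `F(x)`. -/
def x (F : Type*) [Field F] {n : ℕ} (i : Fin n) : RatFun F n :=
  algebraMap (MvPolynomial (Fin n) F) (RatFun F n) (X i)

instance : Algebra.FormallyEtale (MvPolynomial (Fin n) F) (RatFun F n) :=
  Algebra.FormallyEtale.of_isLocalization (nonZeroDivisors (MvPolynomial (Fin n) F))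

/-- The partial derivative with respect to `x_i` as a derivation of the field `F(x)`: the
extension (unique, by the quotient rule) of the partial derivative of polynomials, see
`partialDeriv_algebraMap`. It is built through Kähler differentials, which commute with
localization. -/
def partialDeriv (F : Type*) [Field F] {n : ℕ} (i : Fin n) :
    Derivation F (RatFun F n) (RatFun F n) :=
  (((((Algebra.linearMap (MvPolynomial (Fin n) F) (RatFun F n)).compDer
      (pderiv i : Derivation F (MvPolynomial (Fin n) F)
        (MvPolynomial (Fin n) F))).liftKaehlerDifferential).liftBaseChange (RatFun F n)).comp
    (KaehlerDifferential.tensorKaehlerEquivOfFormallyEtale F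
      (MvPolynomial (Fin n) F) (RatFun F n)).symm.toLinearMap).compDer
    (KaehlerDifferential.D F (RatFun F n))

theorem partialDeriv_algebraMap (i : Fin n) (p : MvPolynomial (Fin n) F) :
    partialDeriv F i (algebraMap _ (RatFun F n) p) = algebraMap _ (RatFun F n) (pderiv i p) := by
  simp [partialDeriv, KaehlerDifferential.tensorKaehlerEquivOfFormallyEtale_symm_D_algebraMap]

/-- The operator `∂_i` on `F(x)`. Operators live in the algebra of `F`-linear endomorphisms of
`F(x)`: the product is composition and, for `a : F(x)`, `a • T` is `T` followed by
multiplication by `a`. -/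
def del (F : Type*) [Field F] {n : ℕ} (i : Fin n) : Module.End F (RatFun F n) :=
  (partialDeriv F i).toLinearMap

/-- `∂^r = ∂_1^{r_1} ∂_2^{r_2} ⋯ ∂_n^{r_n}`. -/
def delPow (F : Type*) [Field F] {n : ℕ} (r : Fin n →₀ ℕ) : Module.End F (RatFun F n) :=
  (List.ofFn fun i => del F i ^ r i).prod

/-- The operator `∑_r a_r(x) ∂^r` with total symbol `p = ∑_r a_r(x) ξ^r`. -/
def opOf (p : MvPolynomial (Fin n) (RatFun F n)) : Module.End F (RatFun F n) :=
  ∑ r ∈ p.support, p.coeff r • delPow F r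

/-- `D` is a differential operator of order `d` with coefficients in `F(x)`:
`D = ∑_{|r| ≤ d} a_r(x) ∂^r` with `a_r ≠ 0` for at least one `r` with `|r| = d`. -/
def IsDiffOpOfOrder (D : Module.End F (RatFun F n)) (d : ℕ) : Prop :=
  ∃ p : MvPolynomial (Fin n) (RatFun F n),
    D = opOf p ∧ (∀ r, p.coeff r ≠ 0 → r.degree ≤ d) ∧ ∃ r, r.degree = d ∧ p.coeff r ≠ 0

/-- The operator `D_{k;q} = ∑_i (q x_i ∂_i^{k+1} + ∂_i^k)`. -/
def steenrodOp (n : ℕ) (q : F) (k : ℕ) : Module.End F (RatFun F n) :=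
  ∑ i : Fin n, ((algebraMap F (RatFun F n) q * x F i) • del F i ^ (k + 1) + del F i ^ k)

/-- `D_{1;q}^{r_1} D_{2;q}^{r_2} ⋯ D_{n;q}^{r_n}`, in this order; the entry `r k`, `k : Fin n`,
is the exponent of `D_{k+1;q}`. -/
def steenrodMonomial (q : F) (r : Fin n → ℕ) : Module.End F (RatFun F n) :=
  (List.ofFn fun k : Fin n => steenrodOp n q (k + 1) ^ r k).prod

/-- `φ_m(ξ) = ∑_i x_i ξ_i^m`, a polynomial in `ξ` over `F(x)`. -/
def phi (F : Type*) [Field F] (n m : ℕ) : MvPolynomial (Fin n) (RatFun F n) :=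
  ∑ i : Fin n, C (x F i) * X i ^ m

/-- The ideal `Φ_n^k = (φ_k, φ_{k+1}, …, φ_{k+n-1})` of `F(x)[ξ]`. -/
def Phi (F : Type*) [Field F] (n k : ℕ) : Ideal (MvPolynomial (Fin n) (RatFun F n)) :=
  Ideal.span (Set.range fun j : Fin n => phi F n (k + j))

/-- The monomials `ξ^{u i}` form a basis of the `F(x)`-vector space `F(x)[ξ] / Φ_n^k`. -/
def IsMonomialBasis (F : Type*) [Field F] {n : ℕ} (k : ℕ) {ι : Type*} (u : ι → Fin n →₀ ℕ) :
    Prop :=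
  LinearIndependent (RatFun F n)
      (fun i => Ideal.Quotient.mk (Phi F n k) (monomial (u i) 1)) ∧
    Submodule.span (RatFun F n)
      (Set.range fun i => Ideal.Quotient.mk (Phi F n k) (monomial (u i) 1)) = ⊤

/-- The finite set of the exponents `r = (r_1, …, r_n)` with `∑_k r_k (k + 1) ≤ d - e`
(with the integer difference, so that there are none if `d < e`; see `mem_expSet`). The entry
`r k`, `k : Fin n`, stands for `r_{k+1}`. -/
def expSet (n d e : ℕ) : Finset (Fin n → ℕ) :=
  {r ∈ Fintype.piFinset (fun _ : Fin n => Finset.range (d + 1)) |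
    ∑ k : Fin n, r k * ((k : ℕ) + 2) + e ≤ d}

theorem mem_expSet {n d e : ℕ} {r : Fin n → ℕ} :
    r ∈ expSet n d e ↔ ((∑ k : Fin n, r k * ((k : ℕ) + 2) : ℕ) : ℤ) ≤ (d : ℤ) - e := by
  have key : ∑ k : Fin n, r k * ((k : ℕ) + 2) + e ≤ d → ∀ k, r k < d + 1 := by
    intro h k
    have h1 : r k * ((k : ℕ) + 2) ≤ ∑ k : Fin n, r k * ((k : ℕ) + 2) :=
      Finset.single_le_sum (f := fun k : Fin n => r k * ((k : ℕ) + 2))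
        (fun _ _ => Nat.zero_le _) (Finset.mem_univ k)
    nlinarith [Nat.zero_le (r k * (k : ℕ))]
  simp only [expSet, Finset.mem_filter, Fintype.mem_piFinset, Finset.mem_range]
  constructor
  · rintro ⟨_, h⟩
    omega
  · intro h
    have h' : ∑ k : Fin n, r k * ((k : ℕ) + 2) + e ≤ d := by omega
    exact ⟨key h', h'⟩

end Steenrod

end

noncomputable section

namespace Steenrod

open MvPolynomial

/-! Spanning. For each `k` the ideal contains the relation `triangularRel k`. In a lexicographic
order on the `x_i` and `ξ_i` together, with every `x_i` above every `ξ_j`, its leading monomial is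
`x_k ξ_k^{k+1}` (`k = 1, …, n`). Choosing for each exponent `m` either `ξ^m` or a monomial multiple
of such a relation gives a family whose leading monomials have distinct `ξ`-parts. It is therefore
independent over `F(x)`, and a dimension count in bounded degree shows that it spans. Modulo the
ideal only the `(n+1)!` box monomials survive (`span_box_eq_top`).

Independence. If `M` monomials span the quotient, the products `ξ^{u i} φ^r` span all polynomials.
Comparing the number of these products with the number of monomials of bounded degree rules out `M <
(n+1)!`, since the latter grows only polynomially (`factorial_le_card_of_span_eq_top`). So no box
monomial is redundant.

Operators. The principal symbol of `u_i(∂) D_{1;q}^{r_1} ⋯ D_{n;q}^{r_n}` is `q^{|r|} ξ^{u i}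
φ_2^{r_1} ⋯ φ_{n+1}^{r_n}`. As `q ≠ 0`, every homogeneous symbol is a combination of these, and
subtracting the corresponding operators lowers the order (`opsLT_le_steenrodSpanLT`). -/

/-- If the nonzero members of a finite family have pairwise distinct degrees for a monomial order
and the family sums to zero, then all its members vanish. -/
theorem eq_zero_of_sum_eq_zero_of_degree_ne {σ R ι : Type*} [CommSemiring R]
    (o : MonomialOrder σ) (s : Finset ι) (f : ι → MvPolynomial σ R)
    (hdeg : ∀ i ∈ s, ∀ j ∈ s, i ≠ j → f i ≠ 0 → f j ≠ 0 → o.degree (f i) ≠ o.degree (f j))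
    (hsum : ∑ i ∈ s, f i = 0) : ∀ i ∈ s, f i = 0 := by
  classical
  by_contra! hne
  obtain ⟨i₀, hi₀, hf₀⟩ := hne
  obtain ⟨i, hi, hmax⟩ := Finset.exists_max_image (s.filter fun i => f i ≠ 0)
    (fun i => o.toSyn (o.degree (f i))) ⟨i₀, by simp [hi₀, hf₀]⟩
  rw [Finset.mem_filter] at hi
  have hc := congrArg (coeff (o.degree (f i))) hsum
  rw [coeff_sum, Finset.sum_eq_single i, coeff_zero] at hc
  · exact hi.2 (o.leadingCoeff_eq_zero_iff.mp hc)
  · intro j hj hji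
    by_cases hfj : f j = 0
    · simp [hfj]
    · refine o.coeff_eq_zero_of_lt (lt_of_le_of_ne (hmax j (by simp [hj, hfj])) ?_)
      exact fun h => hdeg j hj i hi.1 hji hfj hi.2 (o.toSyn.injective h)
  · exact fun h => absurd hi.1 h

/-! ### Leading monomials in the joint variables and independence over `F(x)`. -/

/-- The variables `x_i` and `ξ_i` together, ordered so that in the lexicographic order
`x_1 > ⋯ > x_n > ξ_n > ⋯ > ξ_1`. -/
abbrev JointVar (n : ℕ) : Type := Lex (Fin n ⊕ (Fin n)ᵒᵈ)

variable {F : Type*} [Field F] {n : ℕ}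

/-- The joint variable `x_i`. -/
def coeffVar (i : Fin n) : JointVar n := toLex (Sum.inl i)

/-- The joint variable `ξ_i`. -/
def symbolVar (i : Fin n) : JointVar n := toLex (Sum.inr (OrderDual.toDual i))

theorem coeffVar_injective : Function.Injective (coeffVar (n := n)) :=
  toLex.injective.comp Sum.inl_injective

theorem symbolVar_injective : Function.Injective (symbolVar (n := n)) :=
  toLex.injective.comp (Sum.inr_injective.comp OrderDual.toDual.injective)

theorem coeffVar_ne_symbolVar (i j : Fin n) : coeffVar i ≠ symbolVar j := fun h => by
  simpa using toLex.injective h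

theorem coeffVar_lt {i j : Fin n} : coeffVar i < coeffVar j ↔ i < j :=
  Sum.Lex.inl_lt_inl_iff

theorem symbolVar_lt {i j : Fin n} : symbolVar i < symbolVar j ↔ j < i :=
  Sum.Lex.inr_lt_inr_iff.trans OrderDual.toDual_lt_toDual

theorem coeffVar_lt_symbolVar (i j : Fin n) : coeffVar i < symbolVar j :=
  Sum.Lex.inl_lt_inr _ _

theorem forall_jointVar {p : JointVar n → Prop} :
    (∀ v, p v) ↔ (∀ i, p (coeffVar i)) ∧ ∀ i, p (symbolVar i) :=
  ⟨fun h => ⟨fun _ => h _, fun _ => h _⟩, fun h v => by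
    rcases v with i | i
    exacts [h.1 i, h.2 i]⟩

/-- The lexicographic order on the monomials in the joint variables. -/
abbrev jointOrder (n : ℕ) : MonomialOrder (JointVar n) := MonomialOrder.lex

/-- A polynomial in the joint variables, read as a polynomial in `ξ` over `F(x)`. -/
def ofJoint (F : Type*) [Field F] (n : ℕ) :
    MvPolynomial (JointVar n) F →ₐ[F] MvPolynomial (Fin n) (RatFun F n) :=
  aeval fun v => Sum.elim (fun i => C (x F i)) (fun i => X (OrderDual.ofDual i)) (ofLex v)

@[simp]
theorem ofJoint_coeffVar (i : Fin n) : ofJoint F n (X (coeffVar i)) = C (x F i) := by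
  simp [ofJoint, coeffVar]

@[simp]
theorem ofJoint_symbolVar (i : Fin n) : ofJoint F n (X (symbolVar i)) = X i := by
  simp [ofJoint, symbolVar]

theorem ofJoint_rename_coeffVar (p : MvPolynomial (Fin n) F) :
    ofJoint F n (rename coeffVar p) = C (algebraMap _ (RatFun F n) p) := by
  have : (ofJoint F n).comp (rename coeffVar) =
      (IsScalarTower.toAlgHom F (RatFun F n) (MvPolynomial (Fin n) (RatFun F n))).comp
        (IsScalarTower.toAlgHom F (MvPolynomial (Fin n) F) (RatFun F n)) := by
    ext1 i
    simp [x, MvPolynomial.algebraMap_eq]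
  exact DFunLike.congr_fun this p

theorem ofJoint_injective : Function.Injective (ofJoint F n) := by
  let e : JointVar n ≃ Fin n ⊕ Fin n :=
    ofLex.trans (Equiv.sumCongr (Equiv.refl _) OrderDual.ofDual) |>.trans (Equiv.sumComm _ _)
  have hinj : Function.Injective (MvPolynomial.map (σ := Fin n)
      (algebraMap (MvPolynomial (Fin n) F) (RatFun F n))) :=
    map_injective _ (IsFractionRing.injective _ _)
  have : (ofJoint F n) =
      ((MvPolynomial.mapAlgHom (σ := Fin n)
        (IsScalarTower.toAlgHom F (MvPolynomial (Fin n) F) (RatFun F n))).comp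
        (sumAlgEquiv F (Fin n) (Fin n)).toAlgHom).comp (rename e) := by
    apply MvPolynomial.algHom_ext
    rw [forall_jointVar]
    constructor <;> intro i
    · rw [ofJoint_coeffVar]
      simp [coeffVar, e, x]
    · rw [ofJoint_symbolVar]
      simp [symbolVar, e, ]
  rw [this]
  exact (hinj.comp (sumAlgEquiv F (Fin n) (Fin n)).injective).comp (rename_injective _ e.injective)

theorem degree_rename_coeffVar_symbolVar (p : MvPolynomial (Fin n) F) (j : Fin n) :
    (jointOrder n).degree (rename coeffVar p) (symbolVar j) = 0 := by
  by_cases hp : p = 0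
  · simp [hp]
  have h := (jointOrder n).degree_mem_support
    ((map_ne_zero_iff _ (rename_injective (R := F) _ coeffVar_injective)).mpr hp)
  classical
  rw [support_rename_of_injective coeffVar_injective, Finset.mem_image] at h
  obtain ⟨d, -, hd⟩ := h
  rw [← hd, Finsupp.mapDomain_of_notMem_range]
  rintro ⟨i, hi⟩
  exact coeffVar_ne_symbolVar i j hi

/-- Polynomials whose leading monomials in the joint variables have pairwise distinct `ξ`-parts
are linearly independent over `F(x)`. -/
theorem linearIndependent_ofJoint {ι : Type*} (Q : ι → MvPolynomial (JointVar n) F)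
    (hQ : ∀ i, Q i ≠ 0)
    (hdeg : ∀ i j, (∀ k, (jointOrder n).degree (Q i) (symbolVar k) =
      (jointOrder n).degree (Q j) (symbolVar k)) → i = j) :
    LinearIndependent (RatFun F n) fun i => ofJoint F n (Q i) := by
  -- Clearing denominators: it suffices to exclude relations with coefficients in `F[x]`, which live
  -- in the joint polynomial ring.
  rw [← LinearIndependent.iff_fractionRing (R := MvPolynomial (Fin n) F), linearIndependent_iff']
  intro s g hg
  have hs : ∑ i ∈ s, rename coeffVar (g i) * Q i = 0 := by
    apply ofJoint_injective
    rw [map_sum, map_zero, ← hg]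
    refine Finset.sum_congr rfl fun i _ => ?_
    rw [map_mul, ofJoint_rename_coeffVar, ← smul_eq_C_mul, algebraMap_smul]
  have key := eq_zero_of_sum_eq_zero_of_degree_ne (jointOrder n) s _
    (fun i _ j _ hij hi hj h => ?_) hs
  · intro i hi
    have := (mul_eq_zero.mp (key i hi)).resolve_right (hQ i)
    exact (map_eq_zero_iff _ (rename_injective (R := F) _ coeffVar_injective)).mp this
  -- A factor in the `x_i` alone does not change the `ξ`-part of the leading monomial.
  · rw [MonomialOrder.degree_mul' hi, MonomialOrder.degree_mul' hj] at h
    refine hij (hdeg i j fun k => ?_)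
    simpa [degree_rename_coeffVar_symbolVar] using DFunLike.congr_fun h (symbolVar k)

/-! ### Triangular relations in the ideal. -/

/-- The `i`-th summand of `triangularRel k`. -/
def triangularTerm (F : Type*) [Field F] {n : ℕ} (k i : Fin n) : MvPolynomial (JointVar n) F :=
  X (coeffVar i) * (X (symbolVar i) ^ 2 * ∏ j ∈ Finset.Iio k, (X (symbolVar i) - X (symbolVar j)))

/-- `∑_i x_i ξ_i² ∏_{j < k} (ξ_i - ξ_j)` -/
def triangularRel (F : Type*) [Field F] {n : ℕ} (k : Fin n) : MvPolynomial (JointVar n) F :=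
  ∑ i, triangularTerm F k i

theorem symbolVar_sub_ne_zero {i j : Fin n} (h : i ≠ j) :
    (X (symbolVar i) - X (symbolVar j) : MvPolynomial (JointVar n) F) ≠ 0 :=
  sub_ne_zero.mpr fun e => h (symbolVar_injective (X_injective e))

theorem degree_symbolVar_sub {i j : Fin n} (h : j < i) :
    (jointOrder n).degree (X (symbolVar i) - X (symbolVar j) : MvPolynomial (JointVar n) F) =
      Finsupp.single (symbolVar i) 1 := by
  rw [MonomialOrder.degree_sub_of_lt, MonomialOrder.degree_X]
  rw [MonomialOrder.degree_X, MonomialOrder.degree_X, MonomialOrder.lex_lt_iff,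
    Finsupp.Lex.single_lt_iff]
  exact symbolVar_lt.mpr h

theorem triangularTerm_of_lt {k i : Fin n} (h : i < k) : triangularTerm F k i = 0 := by
  rw [triangularTerm, Finset.prod_eq_zero (Finset.mem_Iio.mpr h) (sub_self _), mul_zero, mul_zero]

theorem triangularTerm_ne_zero {k i : Fin n} (h : k ≤ i) : triangularTerm F k i ≠ 0 := by
  refine mul_ne_zero (X_ne_zero _) (mul_ne_zero (pow_ne_zero _ (X_ne_zero _)) ?_)
  rw [Finset.prod_ne_zero_iff]
  intro j hj
  exact symbolVar_sub_ne_zero ((Finset.mem_Iio.mp hj).trans_le h).ne'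

theorem degree_triangularTerm {k i : Fin n} (h : k ≤ i) :
    (jointOrder n).degree (triangularTerm F k i) =
      Finsupp.single (coeffVar i) 1 + Finsupp.single (symbolVar i) ((k : ℕ) + 2) := by
  have hne := triangularTerm_ne_zero (F := F) h
  unfold triangularTerm at hne ⊢
  rw [MonomialOrder.degree_mul' hne, MonomialOrder.degree_mul' (right_ne_zero_of_mul hne),
    MonomialOrder.degree_pow, MonomialOrder.degree_X, MonomialOrder.degree_X,
    MonomialOrder.degree_prod, Finset.sum_congr rfl fun j hj =>
      degree_symbolVar_sub ((Finset.mem_Iio.mp hj).trans_le h)]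
  · simp [← Finsupp.single_add, add_comm]
  · intro j hj
    exact symbolVar_sub_ne_zero ((Finset.mem_Iio.mp hj).trans_le h).ne'

/-- All `x` variables precede all `ξ` variables, so the comparison is settled at `x_k` whatever the
exponents `a` and `b` are. -/
theorem degree_triangularTerm_lt {k i : Fin n} (h : k < i) (a b : ℕ) :
    (jointOrder n).toSyn (Finsupp.single (coeffVar i) 1 + Finsupp.single (symbolVar i) a) <
      (jointOrder n).toSyn (Finsupp.single (coeffVar k) 1 + Finsupp.single (symbolVar k) b) := by
  rw [MonomialOrder.lex_lt_iff, Finsupp.Lex.lt_iff]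
  refine ⟨coeffVar k, fun v hv => ?_, ?_⟩
  · have h1 : v ≠ coeffVar i := (hv.trans (coeffVar_lt.mpr h)).ne
    have h2 : v ≠ symbolVar i := (hv.trans (coeffVar_lt_symbolVar _ _)).ne
    have h3 : v ≠ symbolVar k := (hv.trans (coeffVar_lt_symbolVar _ _)).ne
    simp [h1.symm, h2.symm, h3.symm, hv.ne']
  · have h1 : coeffVar i ≠ coeffVar k := (coeffVar_lt.mpr h).ne'
    simp [h1, (coeffVar_ne_symbolVar _ _).symm]

/-- The terms with `i < k` vanish because they contain the factor `ξ_i - ξ_i`; those with `i > k`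
carry a smaller `x_i`. Hence the term `i = k` leads. -/
theorem degree_triangularRel (k : Fin n) :
    (jointOrder n).degree (triangularRel F k) =
      Finsupp.single (coeffVar k) 1 + Finsupp.single (symbolVar k) ((k : ℕ) + 2) := by
  rw [triangularRel, ← Finset.add_sum_erase _ _ (Finset.mem_univ k),
    MonomialOrder.degree_add_of_lt, degree_triangularTerm le_rfl]
  rw [degree_triangularTerm le_rfl]
  refine lt_of_le_of_lt MonomialOrder.degree_sum_le ?_
  rw [Finset.sup_lt_iff]
  · intro i hi
    rcases lt_or_gt_of_ne (Finset.ne_of_mem_erase hi) with h | h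
    · rw [triangularTerm_of_lt h, MonomialOrder.degree_zero, map_zero,
        MonomialOrder.toSyn_lt_iff_ne_zero, ne_eq, MonomialOrder.toSyn_eq_zero_iff]
      simp
    · rw [degree_triangularTerm h.le]
      exact degree_triangularTerm_lt h _ _
  · rw [MonomialOrder.bot_eq_zero, MonomialOrder.toSyn_lt_iff_ne_zero, ne_eq,
      MonomialOrder.toSyn_eq_zero_iff]
    simp

theorem triangularRel_ne_zero (k : Fin n) : triangularRel F k ≠ 0 := by
  apply MonomialOrder.ne_zero_of_degree_ne_zero (m := jointOrder n)
  rw [degree_triangularRel]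
  simp

open Classical in
/-- A polynomial whose leading monomial has `ξ`-part `m`: the monomial `ξ^m` itself if all its
exponents satisfy `m_k < k + 1` (for `k = 1, …, n`), and a multiple of some `triangularRel k`
otherwise. -/
def leadingRep (F : Type*) [Field F] {n : ℕ} (m : Fin n →₀ ℕ) : MvPolynomial (JointVar n) F :=
  if h : ∃ k : Fin n, (k : ℕ) + 2 ≤ m k then
    monomial ((m - Finsupp.single h.choose ((h.choose : ℕ) + 2)).mapDomain symbolVar) 1 *
      triangularRel F h.choose
  else monomial (m.mapDomain symbolVar) 1

theorem leadingRep_ne_zero (m : Fin n →₀ ℕ) : leadingRep F m ≠ 0 := by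
  unfold leadingRep
  split_ifs
  · exact mul_ne_zero (by simp) (triangularRel_ne_zero _)
  · simp

theorem degree_leadingRep (m : Fin n →₀ ℕ) (j : Fin n) :
    (jointOrder n).degree (leadingRep F m) (symbolVar j) = m j := by
  classical
  unfold leadingRep
  split_ifs with h
  · rw [MonomialOrder.degree_mul (hf := by simp) (hg := triangularRel_ne_zero _),
      degree_triangularRel, MonomialOrder.degree_monomial, if_neg one_ne_zero]
    have hk := h.choose_spec
    simp only [Finsupp.add_apply, Finsupp.mapDomain_apply symbolVar_injective,
      Finsupp.tsub_apply, Finsupp.single_apply, symbolVar_injective.eq_iff,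
      coeffVar_ne_symbolVar, if_false, zero_add]
    split_ifs with e
    · rw [← e]; omega
    · simp
  · rw [MonomialOrder.degree_monomial, if_neg one_ne_zero,
      Finsupp.mapDomain_apply symbolVar_injective]

theorem linearIndependent_leadingRep :
    LinearIndependent (RatFun F n) fun m : Fin n →₀ ℕ => ofJoint F n (leadingRep F m) := by
  refine linearIndependent_ofJoint _ leadingRep_ne_zero fun i j h => Finsupp.ext fun k => ?_
  simpa [degree_leadingRep] using h k

/-- The product over `j < k` is the value at `ξ_i` of one polynomial `g` of degree less than `n`.
Its coefficients do not depend on `i`, so expanding `g` and summing over `i` produces a combination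
of the generators. -/
theorem ofJoint_triangularRel_mem_Phi (k : Fin n) : ofJoint F n (triangularRel F k) ∈ Phi F n 2 := by
  let g : Polynomial (MvPolynomial (Fin n) (RatFun F n)) :=
    ∏ j ∈ Finset.Iio k, (Polynomial.X - Polynomial.C (X j))
  have hg : g.natDegree < n := by
    rw [Polynomial.natDegree_finsetProd_X_sub_C_eq_card, Fin.card_Iio]
    exact k.2
  have h : ofJoint F n (triangularRel F k) = ∑ l : Fin n, g.coeff l * phi F n (2 + l) := by
    simp only [triangularRel, triangularTerm, map_sum, map_mul, map_pow, map_prod, map_sub,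
      ofJoint_coeffVar, ofJoint_symbolVar, phi, Finset.mul_sum]
    rw [Finset.sum_comm]
    refine Finset.sum_congr rfl fun i _ => ?_
    have hi : ∏ j ∈ Finset.Iio k, (X i - X j) = g.eval (X i) := by
      simp [g, Polynomial.eval_prod]
    rw [hi, Polynomial.eval_eq_sum_range' hg, ← Fin.sum_univ_eq_sum_range
      (fun l => g.coeff l * X i ^ l), Finset.mul_sum, Finset.mul_sum]
    exact Finset.sum_congr rfl fun l _ => by ring
  rw [h]
  exact sum_mem fun l _ => Ideal.mul_mem_left _ _ (Ideal.subset_span ⟨l, rfl⟩)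

theorem isHomogeneous_phi (m : ℕ) : (phi F n m).IsHomogeneous m :=
  IsHomogeneous.sum _ _ _ fun i _ => isHomogeneous_C_mul_X_pow _ i m

theorem totalDegree_ofJoint_triangularRel_le (k : Fin n) :
    (ofJoint F n (triangularRel F k)).totalDegree ≤ (k : ℕ) + 2 := by
  refine IsHomogeneous.totalDegree_le ?_
  rw [triangularRel, map_sum]
  refine IsHomogeneous.sum _ _ _ fun i _ => ?_
  simp only [triangularTerm, map_mul, map_pow, map_prod, map_sub, ofJoint_coeffVar,
    ofJoint_symbolVar]
  refine IsHomogeneous.C_mul ?_ _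
  rw [add_comm]
  refine (isHomogeneous_X_pow i 2).mul ?_
  convert IsHomogeneous.prod (Finset.Iio k)
    (fun j => (X i - X j : MvPolynomial (Fin n) (RatFun F n))) (fun _ => 1)
    (fun j _ => (isHomogeneous_X _ i).sub (isHomogeneous_X _ j))
  simp

theorem ofJoint_monomial_mapDomain (m : Fin n →₀ ℕ) :
    ofJoint F n (monomial (m.mapDomain symbolVar) 1) = monomial m 1 := by
  rw [monomial_eq, Finsupp.prod_mapDomain_index_inj symbolVar_injective, monomial_eq]
  simp [Finsupp.prod]

theorem totalDegree_ofJoint_leadingRep_le (m : Fin n →₀ ℕ) :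
    (ofJoint F n (leadingRep F m)).totalDegree ≤ m.degree := by
  unfold leadingRep
  split_ifs with h
  · have hk := h.choose_spec
    set k := h.choose
    rw [map_mul, ofJoint_monomial_mapDomain]
    refine (totalDegree_mul _ _).trans ?_
    have h1 : m - Finsupp.single k ((k : ℕ) + 2) + Finsupp.single k ((k : ℕ) + 2) = m :=
      tsub_add_cancel_of_le (Finsupp.single_le_iff.mpr hk)
    have h2 := congrArg Finsupp.degree h1
    rw [map_add, Finsupp.degree_single] at h2
    rw [← h2]
    exact add_le_add ((isHomogeneous_monomial _ rfl).totalDegree_le)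
      (totalDegree_ofJoint_triangularRel_le k)
  · rw [ofJoint_monomial_mapDomain]
    exact (isHomogeneous_monomial _ rfl).totalDegree_le

/-! ### The box monomials span the quotient. -/

/-- The exponents `e` with `e_k < k + 1` for `k = 1, …, n`. -/
def boxExp (e : (k : Fin n) → Fin ((k : ℕ) + 2)) : Fin n →₀ ℕ :=
  Finsupp.equivFunOnFinite.symm fun k => e k

theorem card_box (n : ℕ) : Fintype.card ((k : Fin n) → Fin ((k : ℕ) + 2)) = (n + 1).factorial := by
  rw [Fintype.card_pi]
  simp only [Fintype.card_fin]
  rw [Fin.prod_univ_eq_prod_range (fun k => k + 2), ← Finset.prod_range_add_one_eq_factorial,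
    Finset.prod_range_succ']
  simp

instance finite_degree_le (N : ℕ) : Finite {m : Fin n →₀ ℕ | m.degree ≤ N} :=
  Finsupp.finite_of_degree_le N

/-- A linearly independent family of polynomials indexed by the monomials, of no larger degree than
these, spans the polynomials. -/
theorem mem_span_of_totalDegree_le {σ K : Type*} [Finite σ] [Field K]
    (P : (σ →₀ ℕ) → MvPolynomial σ K) (hli : LinearIndependent K P)
    (hdeg : ∀ m, (P m).totalDegree ≤ m.degree) (p : MvPolynomial σ K) :
    p ∈ Submodule.span K (Set.range P) := by
  let S : Set (σ →₀ ℕ) := {m | m.degree ≤ p.totalDegree}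
  have : Finite S := Finsupp.finite_of_degree_le p.totalDegree
  have : Fintype S := Fintype.ofFinite S
  have hle (q : MvPolynomial σ K) (hq : q.totalDegree ≤ p.totalDegree) : q ∈ restrictSupport K S :=
    fun m hm => (le_totalDegree hm).trans hq
  have hb := basisRestrictSupport K S
  have : Module.Finite K (restrictSupport K S) := Module.Finite.of_basis hb
  let Q : S → restrictSupport K S := fun m => ⟨P m.1, hle _ ((hdeg _).trans m.2)⟩
  have hQ : LinearIndependent K Q :=
    LinearIndependent.of_comp (Submodule.subtype _) (hli.comp _ Subtype.val_injective)
  -- The members indexed by `S` are as many as the monomials that form a basis of this space.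
  have hspan := hQ.span_eq_top_of_card_eq_finrank' (Module.finrank_eq_card_basis hb).symm
  have hp : (⟨p, hle p le_rfl⟩ : restrictSupport K S) ∈ Submodule.span K (Set.range Q) :=
    hspan ▸ Submodule.mem_top
  have := Submodule.mem_map_of_mem (f := Submodule.subtype _) hp
  rw [Submodule.map_span, ← Set.range_comp] at this
  refine Submodule.span_mono ?_ this
  rintro _ ⟨m, rfl⟩
  exact ⟨m.1, rfl⟩

theorem mem_span_leadingRep (p : MvPolynomial (Fin n) (RatFun F n)) :
    p ∈ Submodule.span (RatFun F n)
      (Set.range fun m : Fin n →₀ ℕ => ofJoint F n (leadingRep F m)) := by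
  refine mem_span_of_totalDegree_le _ ?_ ?_ p
  · exact linearIndependent_leadingRep
  · exact totalDegree_ofJoint_leadingRep_le

/-- The polynomials from `leadingRep` span. Those with an exponent outside the box are multiples of
a triangular relation and vanish in the quotient; the others are the box monomials. -/
theorem span_box_eq_top :
    Submodule.span (RatFun F n) (Set.range fun e : (k : Fin n) → Fin ((k : ℕ) + 2) =>
      Ideal.Quotient.mk (Phi F n 2) (monomial (boxExp e) 1)) = ⊤ := by
  rw [eq_top_iff]
  rintro y -
  obtain ⟨p, rfl⟩ := Ideal.Quotient.mk_surjective y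
  have := Submodule.mem_map_of_mem (f := (Ideal.Quotient.mkₐ (RatFun F n) (Phi F n 2)).toLinearMap)
    (mem_span_leadingRep p)
  rw [Submodule.map_span, ← Set.range_comp] at this
  refine Submodule.span_le.mpr ?_ this
  rintro _ ⟨m, rfl⟩
  simp only [Function.comp_apply, AlgHom.toLinearMap_apply, Ideal.Quotient.mkₐ_eq_mk, SetLike.mem_coe]
  unfold leadingRep
  split_ifs with h
  · rw [map_mul, map_mul, Ideal.Quotient.eq_zero_iff_mem.mpr (ofJoint_triangularRel_mem_Phi _),
      mul_zero]
    exact zero_mem _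
  · rw [ofJoint_monomial_mapDomain]
    push Not at h
    refine Submodule.subset_span ⟨fun k => ⟨m k, h k⟩, ?_⟩
    simp [boxExp]

/-! ### Homogeneous polynomials as combinations of monomials times products of the `φ_m`. -/

/-- `ξ^m φ_2^{r_1} ⋯ φ_{n+1}^{r_n}` -/
def symbolProd (F : Type*) [Field F] {n : ℕ} (m : Fin n →₀ ℕ) (r : Fin n → ℕ) :
    MvPolynomial (Fin n) (RatFun F n) :=
  monomial m 1 * ∏ k : Fin n, phi F n ((k : ℕ) + 2) ^ r k

theorem symbolProd_mul_phi (m : Fin n →₀ ℕ) (r : Fin n → ℕ) (j : Fin n) :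
    symbolProd F m r * phi F n (2 + j) = symbolProd F m (r + Pi.single j 1) := by
  have : phi F n (2 + j) = ∏ k : Fin n, phi F n ((k : ℕ) + 2) ^ (Pi.single j 1 : Fin n → ℕ) k := by
    rw [Finset.prod_eq_single j] <;> simp +contextual [add_comm]
  rw [this, symbolProd, symbolProd, mul_assoc, ← Finset.prod_mul_distrib]
  simp [pow_add]

theorem homogeneousComponent_mul_of_isHomogeneous_right {σ R : Type*} [CommRing R]
    {p q : MvPolynomial σ R} {e : ℕ} (hq : q.IsHomogeneous e) (d : ℕ) :
    homogeneousComponent d (p * q) = if e ≤ d then homogeneousComponent (d - e) p * q else 0 := by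
  let _ : GradedAlgebra (homogeneousSubmodule σ R) := gradedAlgebra
  have hdec (f : MvPolynomial σ R) (i : ℕ) :
      (DirectSum.decompose (homogeneousSubmodule σ R) f i : MvPolynomial σ R) =
        homogeneousComponent i f := decomposition.decompose'_apply f i
  have := DirectSum.coe_decompose_mul_of_right_mem (homogeneousSubmodule σ R) d (a := p) hq
  rwa [hdec, hdec] at this

/-- If the classes of the monomials `ξ^{u i}` span `F(x)[ξ] / Φ_n^2`, then every homogeneous
polynomial of degree `d` is a combination of the products `ξ^{u i} φ_2^{r_1} ⋯ φ_{n+1}^{r_n}` of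
degree `d`. -/
theorem mem_span_symbolProd {ι : Type*} [Finite ι] {u : ι → Fin n →₀ ℕ}
    (hu : Submodule.span (RatFun F n)
      (Set.range fun i => Ideal.Quotient.mk (Phi F n 2) (monomial (u i) 1)) = ⊤)
    (d : ℕ) (p : MvPolynomial (Fin n) (RatFun F n)) (hp : p.IsHomogeneous d) :
    p ∈ Submodule.span (RatFun F n) {s | ∃ (i : ι) (r : Fin n → ℕ),
      ∑ k : Fin n, r k * ((k : ℕ) + 2) + (u i).degree = d ∧ s = symbolProd F (u i) r} := by
  have := Fintype.ofFinite ι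
  induction d using Nat.strong_induction_on generalizing p with
  | _ d ih =>
  have hmem : Ideal.Quotient.mk (Phi F n 2) p ∈ Submodule.span (RatFun F n)
      (Set.range fun i => Ideal.Quotient.mk (Phi F n 2) (monomial (u i) 1)) :=
    hu ▸ Submodule.mem_top
  obtain ⟨c, hc⟩ := (Submodule.mem_span_range_iff_exists_fun _).mp hmem
  have hPhi : p - ∑ i, c i • monomial (u i) 1 ∈ Phi F n 2 := by
    rw [← Ideal.Quotient.eq_zero_iff_mem, map_sub, ← hc, map_sum, sub_eq_zero]
    rfl
  rw [Phi] at hPhi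
  obtain ⟨a, ha⟩ := (Ideal.mem_span_range_iff_exists_fun).mp hPhi
  -- Passing to the component of degree `d` replaces the coefficient of `φ_{2+j}` by its component
  -- of degree `d - (2 + j) < d`, to which the induction hypothesis applies.
  have hcomp := congrArg (homogeneousComponent d) (sub_eq_iff_eq_add.mp ha.symm)
  rw [homogeneousComponent_eq_self hp, map_add, map_sum, map_sum] at hcomp
  rw [hcomp]
  refine add_mem (sum_mem fun j _ => ?_) (sum_mem fun i _ => ?_)
  · rw [homogeneousComponent_mul_of_isHomogeneous_right (isHomogeneous_phi _)]
    split_ifs with hj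
    · have h := Submodule.mem_map_of_mem (f := LinearMap.mulRight (RatFun F n) (phi F n (2 + j)))
        (ih _ (by omega) _ (homogeneousComponent_isHomogeneous (d - (2 + j)) (a j)))
      rw [Submodule.map_span] at h
      refine Submodule.span_mono ?_ h
      rintro _ ⟨_, ⟨i, r, hr, rfl⟩, rfl⟩
      refine ⟨i, r + Pi.single j 1, ?_, symbolProd_mul_phi _ _ _⟩
      have : ∑ k : Fin n, (Pi.single j 1 : Fin n → ℕ) k * ((k : ℕ) + 2) = j + 2 := by
        rw [Finset.sum_eq_single j] <;> simp +contextual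
      simp only [Pi.add_apply, add_mul, Finset.sum_add_distrib, this]
      omega
    · exact zero_mem _
  · rw [map_smul]
    refine Submodule.smul_mem _ _ ?_
    rw [homogeneousComponent_of_mem (isHomogeneous_monomial 1 rfl)]
    split_ifs with hi
    · exact Submodule.subset_span ⟨i, 0, by simp [hi], by simp [symbolProd]⟩
    · exact zero_mem _

/-! ### Counting: a spanning family of monomials has at least `(n+1)!` members. -/

/-- The number of monomials of degree at most `N` in `n` variables. -/
def numMonomials (n N : ℕ) : ℕ := Nat.card {m : Fin n →₀ ℕ | m.degree ≤ N}

theorem numMonomials_pos (n N : ℕ) : 0 < numMonomials n N := by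
  have : Nonempty {m : Fin n →₀ ℕ | m.degree ≤ N} := ⟨0, by simp⟩
  exact Nat.card_pos

theorem numMonomials_le (n N : ℕ) : numMonomials n N ≤ (N + 1) ^ n := by
  have h := Nat.card_le_card_of_injective
    (fun m : {m : Fin n →₀ ℕ | m.degree ≤ N} => fun i : Fin n =>
      (⟨m.1 i, Nat.lt_succ_of_le ((Finsupp.le_degree i m.1).trans m.2)⟩ : Fin (N + 1)))
    (fun a b h => Subtype.ext (Finsupp.ext fun i => congrArg Fin.val (congrFun h i)))
  simpa [numMonomials] using h

theorem numMonomials_le_card_mul {ι : Type*} [Fintype ι] {u : ι → Fin n →₀ ℕ}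
    (hu : Submodule.span (RatFun F n)
      (Set.range fun i => Ideal.Quotient.mk (Phi F n 2) (monomial (u i) 1)) = ⊤) (N : ℕ) :
    numMonomials n N ≤ Fintype.card ι * (expSet n N 0).card := by
  classical
  let S : Set (Fin n →₀ ℕ) := {m | m.degree ≤ N}
  have : Fintype S := Fintype.ofFinite S
  let T := (Finset.univ ×ˢ expSet n N 0).image fun t : ι × (Fin n → ℕ) => symbolProd F (u t.1) t.2
  have hle : restrictSupport (RatFun F n) S ≤ Submodule.span (RatFun F n) (T : Set _) := by
    rw [restrictSupport_eq_span, Submodule.span_le]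
    rintro _ ⟨m, hm, rfl⟩
    refine Submodule.span_mono ?_ (mem_span_symbolProd hu m.degree _ (isHomogeneous_monomial 1 rfl))
    rintro _ ⟨i, r, hr, rfl⟩
    refine Finset.mem_coe.mpr (Finset.mem_image.mpr ⟨(i, r), ?_, rfl⟩)
    have hm' : m.degree ≤ N := hm
    simp only [Finset.mem_product, Finset.mem_univ, true_and, mem_expSet]
    omega
  have h1 := Submodule.finrank_mono hle
  rw [Module.finrank_eq_card_basis (basisRestrictSupport (RatFun F n) S),
    ← Nat.card_eq_fintype_card] at h1
  refine (h1.trans (finrank_span_finset_le_card T)).trans (Finset.card_image_le.trans ?_)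
  rw [Finset.card_product, Finset.card_univ]

/-- Division with remainder by `k + 2` in each coordinate makes `(e, r) ↦ e_k + r_k (k + 2)`
injective. The remainders `e_k ≤ k + 1` add at most the stated sum to the degree. -/
theorem factorial_mul_card_expSet_le (n N : ℕ) :
    (n + 1).factorial * (expSet n N 0).card ≤ numMonomials n (N + ∑ k : Fin n, ((k : ℕ) + 1)) := by
  rw [← card_box, ← Fintype.card_coe, ← Fintype.card_prod, ← Nat.card_eq_fintype_card]
  refine Nat.card_le_card_of_injective (fun t => ⟨Finsupp.equivFunOnFinite.symm fun k =>
    t.1 k + t.2.1 k * ((k : ℕ) + 2), ?_⟩) ?_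
  · have ht := mem_expSet.mp t.2.2
    have h1 : ∑ k : Fin n, (t.1 k : ℕ) ≤ ∑ k : Fin n, ((k : ℕ) + 1) :=
      Finset.sum_le_sum fun k _ => Nat.lt_succ_iff.mp (t.1 k).2
    rw [Set.mem_ofPred_eq, Finsupp.degree_eq_sum]
    simp only [Finsupp.equivFunOnFinite_symm_apply_apply, Finset.sum_add_distrib] at h1 ⊢
    omega
  · rintro ⟨e, r, hr⟩ ⟨e', r', hr'⟩ h
    have h' : ∀ k : Fin n, (e k : ℕ) + r k * ((k : ℕ) + 2) = e' k + r' k * ((k : ℕ) + 2) := fun k =>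
      DFunLike.congr_fun (congrArg Subtype.val h) k
    have he : e = e' := by
      funext k
      have := congrArg (· % ((k : ℕ) + 2)) (h' k)
      simp only [Nat.add_mul_mod_self_right, Nat.mod_eq_of_lt (e k).2,
        Nat.mod_eq_of_lt (e' k).2] at this
      exact Fin.ext this
    subst he
    have hr : r = r' := by
      funext k
      have := h' k
      simpa using this
    subst hr
    rfl

/-- A family of monomials that spans `F(x)[ξ] / Φ_n^2` has at least `(n + 1)!` members. -/
theorem factorial_le_card_of_span_eq_top {ι : Type*} [Fintype ι] {u : ι → Fin n →₀ ℕ}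
    (hu : Submodule.span (RatFun F n)
      (Set.range fun i => Ideal.Quotient.mk (Phi F n 2) (monomial (u i) 1)) = ⊤) :
    (n + 1).factorial ≤ Fintype.card ι := by
  by_contra! hlt
  set M := Fintype.card ι
  set c := ∑ k : Fin n, ((k : ℕ) + 1)
  have hstep (N : ℕ) : (M + 1) * numMonomials n N ≤ M * numMonomials n (N + c) :=
    calc (M + 1) * numMonomials n N ≤ (n + 1).factorial * (M * (expSet n N 0).card) :=
          Nat.mul_le_mul hlt (numMonomials_le_card_mul hu N)
      _ = M * ((n + 1).factorial * (expSet n N 0).card) := by ring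
      _ ≤ _ := Nat.mul_le_mul_left _ (factorial_mul_card_expSet_le n N)
  -- Iterating `hstep` forces exponential growth with ratio `(M + 1) / M` along the multiples of
  -- `c`.
  have hpow (j : ℕ) : (M + 1) ^ j ≤ M ^ j * numMonomials n (j * c) := by
    induction j with
    | zero => simpa using Nat.one_le_iff_ne_zero.mpr (numMonomials_pos n 0).ne'
    | succ j ih =>
      calc (M + 1) ^ (j + 1) ≤ M ^ j * numMonomials n (j * c) * (M + 1) := by
            rw [pow_succ]; exact Nat.mul_le_mul_right _ ih
        _ = M ^ j * ((M + 1) * numMonomials n (j * c)) := by ring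
        _ ≤ M ^ j * (M * numMonomials n (j * c + c)) := Nat.mul_le_mul_left _ (hstep _)
        _ = _ := by rw [add_mul, one_mul]; ring
  have hr : |(M / (M + 1) : ℝ)| < 1 := by
    rw [abs_of_nonneg (by positivity), div_lt_one (by positivity)]
    linarith
  -- The polynomial bound `((c + 1) j)^n` cannot keep up: its product with `(M / (M + 1))^j` tends
  -- to zero.
  have hlim := (tendsto_pow_const_mul_const_pow_of_abs_lt_one n hr).const_mul ((c + 1 : ℝ) ^ n)
  rw [mul_zero] at hlim
  obtain ⟨j, hj1, hj⟩ := ((Filter.eventually_ge_atTop 1).and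
    (hlim.eventually_lt_const one_pos)).exists
  refine absurd hj (not_lt.mpr ?_)
  -- Here `j ≥ 1` gives `j c + 1 ≤ (c + 1) j`.
  have h1 : (M + 1) ^ j ≤ M ^ j * ((c + 1) * j) ^ n := by
    refine (hpow j).trans (Nat.mul_le_mul_left _ ((numMonomials_le _ _).trans ?_))
    refine Nat.pow_le_pow_left ?_ n
    rw [add_mul, one_mul, mul_comm j]
    omega
  have h2 : ((M : ℝ) + 1) ^ j ≤ M ^ j * ((c + 1) * j) ^ n := by exact_mod_cast h1
  rw [div_pow, ← mul_assoc, ← mul_pow, mul_div_assoc', le_div_iff₀ (by positivity), one_mul,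
    mul_comm]
  exact h2

/-- If a box monomial lay in the span of the others, the remaining `(n+1)! - 1` would still span,
against the counting bound. -/
theorem exists_isMonomialBasis (F : Type*) [Field F] (n : ℕ) :
    ∃ u : Fin (n + 1).factorial → Fin n →₀ ℕ, IsMonomialBasis F 2 u := by
  classical
  let e := (Fintype.equivFinOfCardEq (card_box n)).symm
  have hspan : Submodule.span (RatFun F n) (Set.range fun i =>
      Ideal.Quotient.mk (Phi F n 2) (monomial (boxExp (e i)) 1)) = ⊤ := by
    rw [← span_box_eq_top, ← e.surjective.range_comp]
    rfl
  refine ⟨fun i => boxExp (e i), ?_, hspan⟩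
  rw [linearIndependent_iff_notMem_span]
  intro i hi
  have hspan' : Submodule.span (RatFun F n) (Set.range fun j : {j // j ≠ i} =>
      Ideal.Quotient.mk (Phi F n 2) (monomial (boxExp (e j)) 1)) = ⊤ := by
    rw [eq_top_iff, ← hspan, Submodule.span_le]
    rintro _ ⟨j, rfl⟩
    by_cases hj : j = i
    · subst hj
      refine Submodule.span_mono ?_ hi
      rintro _ ⟨k, hk, rfl⟩
      exact ⟨⟨k, by simpa using hk⟩, rfl⟩
    · exact Submodule.subset_span ⟨⟨j, hj⟩, rfl⟩
  have := factorial_le_card_of_span_eq_top hspan'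
  rw [Fintype.card_subtype_compl, Fintype.card_fin, Fintype.card_subtype_eq] at this
  have := (n + 1).factorial_pos
  omega

/-! ### Composition of the operators `∂^r` and multiplications. -/

/-- The commutator is a derivation that kills the variables, hence the polynomials. The Leibniz rule
for `(p / q) · q = p` then shows that it kills fractions. -/
theorem partialDeriv_comm (i j : Fin n) (a : RatFun F n) :
    partialDeriv F i (partialDeriv F j a) = partialDeriv F j (partialDeriv F i a) := by
  have hpoly (p : MvPolynomial (Fin n) F) : pderiv i (pderiv j p) = pderiv j (pderiv i p) := by
    have h : ⁅pderiv (R := F) i, pderiv (R := F) j⁆ = 0 := by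
      classical
      ext k
      simp [Derivation.commutator_apply, pderiv_X, Pi.single_apply, apply_ite]
    have := DFunLike.congr_fun h p
    rwa [Derivation.commutator_apply, Derivation.zero_apply, sub_eq_zero] at this
  let E : Derivation F (RatFun F n) (RatFun F n) := ⁅partialDeriv F i, partialDeriv F j⁆
  have hE (p : MvPolynomial (Fin n) F) : E (algebraMap _ _ p) = 0 := by
    simp only [E, Derivation.commutator_apply, partialDeriv_algebraMap, hpoly, sub_self]
  have : E a = 0 := by
    obtain ⟨p, q, hq, rfl⟩ := IsFractionRing.div_surjective (MvPolynomial (Fin n) F) a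
    have hq0 : algebraMap _ (RatFun F n) q ≠ 0 := IsFractionRing.to_map_ne_zero_of_mem_nonZeroDivisors hq
    have h := E.leibniz (algebraMap _ _ p / algebraMap _ _ q) (algebraMap _ (RatFun F n) q)
    rw [div_mul_cancel₀ _ hq0, hE, hE, smul_zero, zero_add, smul_eq_mul] at h
    exact (mul_eq_zero.mp h.symm).resolve_left hq0
  rwa [Derivation.commutator_apply, sub_eq_zero] at this

theorem commute_del (i j : Fin n) : Commute (del F i) (del F j) :=
  LinearMap.ext fun a => partialDeriv_comm i j a

/-- `∂_i ∘ a = a ∂_i + ∂_i(a)` -/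
theorem del_mul_smul (i : Fin n) (a : RatFun F n) (D : Module.End F (RatFun F n)) :
    del F i * (a • D) = a • (del F i * D) + partialDeriv F i a • D := by
  ext b
  change partialDeriv F i (a • D b) = a • partialDeriv F i (D b) + partialDeriv F i a • D b
  rw [smul_eq_mul, Derivation.leibniz]
  simp [mul_comm]

theorem smul_mul_end (a : RatFun F n) (D E : Module.End F (RatFun F n)) :
    (a • D) * E = a • (D * E) := rfl

theorem prod_ofFn_pow_add_single {M : Type*} [Monoid M] {n : ℕ} (f : Fin n → M)
    (hf : ∀ i j, Commute (f i) (f j)) (i : Fin n) (r : Fin n → ℕ) :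
    (List.ofFn fun k => f k ^ (r + Pi.single i 1 : Fin n → ℕ) k).prod =
      f i * (List.ofFn fun k => f k ^ r k).prod := by
  induction n with
  | zero => exact i.elim0
  | succ n ih =>
    simp only [List.ofFn_succ, List.prod_cons]
    cases i using Fin.cases with
    | zero => simp [pow_succ', mul_assoc]
    | succ i =>
      have h := ih (fun k => f k.succ) (fun _ _ => hf _ _) i (fun k => r k.succ)
      have h' : ∀ k : Fin n, (r + Pi.single i.succ 1 : Fin (n + 1) → ℕ) k.succ =
          ((fun k : Fin n => r k.succ) + Pi.single i 1 : Fin n → ℕ) k := fun k => by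
        simp [Pi.single_apply]
      simp only [h', h]
      rw [← mul_assoc, ← mul_assoc]
      congr 1
      simpa using ((hf i.succ 0).pow_right _).eq.symm

theorem delPow_zero : delPow F (0 : Fin n →₀ ℕ) = 1 := by
  simp [delPow]

theorem delPow_add_single (r : Fin n →₀ ℕ) (i : Fin n) :
    delPow F (r + Finsupp.single i 1) = del F i * delPow F r := by
  rw [delPow, delPow, ← prod_ofFn_pow_add_single _ commute_del]
  simp [Finsupp.single_eq_pi_single]

theorem delPow_add_single_pow (r : Fin n →₀ ℕ) (i : Fin n) (b : ℕ) :
    delPow F (r + Finsupp.single i b) = del F i ^ b * delPow F r := by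
  induction b with
  | zero => simp
  | succ b ih => rw [Finsupp.single_add, ← add_assoc, delPow_add_single, ih, pow_succ', mul_assoc]

/-- The map from total symbols to operators, as an `F(x)`-linear map. -/
def symbolMap (F : Type*) [Field F] (n : ℕ) :
    MvPolynomial (Fin n) (RatFun F n) →ₗ[RatFun F n] Module.End F (RatFun F n) :=
  (basisMonomials (Fin n) (RatFun F n)).constr (RatFun F n) (delPow F)

theorem symbolMap_monomial (r : Fin n →₀ ℕ) (a : RatFun F n) :
    symbolMap F n (monomial r a) = a • delPow F r := by
  rw [← mul_one a, ← smul_eq_mul, ← smul_monomial, map_smul, smul_eq_mul, mul_one]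
  congr 1
  have := (basisMonomials (Fin n) (RatFun F n)).constr_basis (RatFun F n) (delPow F) r
  rwa [coe_basisMonomials] at this

/-! ### Principal symbols. -/

/-- The differential operators of order less than `d`. -/
def opsLT (F : Type*) [Field F] (n d : ℕ) : Submodule (RatFun F n) (Module.End F (RatFun F n)) :=
  Submodule.span (RatFun F n) (delPow F '' {r | r.degree < d})

theorem delPow_mem_opsLT {r : Fin n →₀ ℕ} {d : ℕ} (h : r.degree < d) : delPow F r ∈ opsLT F n d :=
  Submodule.subset_span ⟨r, h, rfl⟩

theorem opsLT_mono {d e : ℕ} (h : d ≤ e) : opsLT F n d ≤ opsLT F n e :=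
  Submodule.span_mono (Set.image_mono fun _ hr => lt_of_lt_of_le hr h)

theorem del_mul_mem_opsLT (i : Fin n) {d : ℕ} {D : Module.End F (RatFun F n)}
    (hD : D ∈ opsLT F n d) : del F i * D ∈ opsLT F n (d + 1) := by
  induction hD using Submodule.span_induction with
  | mem D hD =>
    obtain ⟨r, hr, rfl⟩ := hD
    rw [← delPow_add_single]
    have hr' : r.degree < d := hr
    exact delPow_mem_opsLT (by simpa using hr')
  | zero => rw [mul_zero]; exact zero_mem _
  | add D E _ _ hD hE => rw [mul_add]; exact add_mem hD hE
  | smul a D hD h =>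
    rw [del_mul_smul]
    exact add_mem (Submodule.smul_mem _ _ h) (Submodule.smul_mem _ _ (opsLT_mono d.le_succ hD))

/-- `D` is an operator of order at most `d` whose terms of order `d` have the symbol `p`. -/
def HasPrincipalSymbol (d : ℕ) (D : Module.End F (RatFun F n))
    (p : MvPolynomial (Fin n) (RatFun F n)) : Prop :=
  p.IsHomogeneous d ∧ D - symbolMap F n p ∈ opsLT F n d

namespace HasPrincipalSymbol

variable {d : ℕ} {D E : Module.End F (RatFun F n)} {p s : MvPolynomial (Fin n) (RatFun F n)}

theorem monomial (r : Fin n →₀ ℕ) :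
    HasPrincipalSymbol r.degree (delPow F r) (MvPolynomial.monomial r 1) := by
  refine ⟨isHomogeneous_monomial _ rfl, ?_⟩
  rw [symbolMap_monomial, one_smul, sub_self]
  exact zero_mem _

theorem add (hD : HasPrincipalSymbol d D p) (hE : HasPrincipalSymbol d E s) :
    HasPrincipalSymbol d (D + E) (p + s) := by
  refine ⟨hD.1.add hE.1, ?_⟩
  rw [map_add, add_sub_add_comm]
  exact add_mem hD.2 hE.2

theorem zero (d : ℕ) : HasPrincipalSymbol d (0 : Module.End F (RatFun F n)) 0 :=
  ⟨isHomogeneous_zero _ _ _, by simp⟩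

theorem sum {ι : Type*} (t : Finset ι) (D : ι → Module.End F (RatFun F n))
    (p : ι → MvPolynomial (Fin n) (RatFun F n)) (h : ∀ i ∈ t, HasPrincipalSymbol d (D i) (p i)) :
    HasPrincipalSymbol d (∑ i ∈ t, D i) (∑ i ∈ t, p i) := by
  classical
  induction t using Finset.induction_on with
  | empty => simpa using zero d
  | insert i t hi ih =>
    rw [Finset.sum_insert hi, Finset.sum_insert hi]
    exact (h i (Finset.mem_insert_self i t)).add
      (ih fun j hj => h j (Finset.mem_insert_of_mem hj))

theorem smul (a : RatFun F n) (hD : HasPrincipalSymbol d D p) :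
    HasPrincipalSymbol d (a • D) (a • p) := by
  refine ⟨?_, ?_⟩
  · rw [smul_eq_C_mul]
    exact hD.1.C_mul a
  · rw [map_smul, show a • D - a • symbolMap F n p = a • (D - symbolMap F n p) from
      (smul_sub _ _ _).symm]
    exact Submodule.smul_mem _ _ hD.2

theorem mem_opsLT (hD : HasPrincipalSymbol d D p) : D ∈ opsLT F n (d + 1) := by
  rw [← sub_add_cancel D (symbolMap F n p)]
  refine add_mem (opsLT_mono d.le_succ hD.2) ?_
  rw [p.as_sum, map_sum]
  refine sum_mem fun r hr => ?_
  rw [symbolMap_monomial]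
  refine Submodule.smul_mem _ _ (delPow_mem_opsLT ?_)
  have hr' : r.degree = d := (hD.1.degree_eq_sum_deg_support hr).symm
  omega

theorem add_mem_opsLT (hD : HasPrincipalSymbol d D p) (hE : E ∈ opsLT F n d) :
    HasPrincipalSymbol d (D + E) p := by
  refine ⟨hD.1, ?_⟩
  rw [add_sub_right_comm]
  exact add_mem hD.2 hE

theorem del_mul (i : Fin n) (hD : HasPrincipalSymbol d D p) :
    HasPrincipalSymbol (d + 1) (del F i * D) (X i * p) := by
  refine ⟨?_, ?_⟩
  · rw [add_comm]
    exact (isHomogeneous_X _ i).mul hD.1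
  rw [← sub_add_sub_cancel _ (del F i * symbolMap F n p), ← mul_sub]
  refine add_mem (del_mul_mem_opsLT i hD.2) ?_
  -- Term by term, moving `∂_i` past a coefficient leaves only the derivative of that coefficient
  -- times `∂^r`, of order `d`.
  rw [p.as_sum, Finset.mul_sum, map_sum, map_sum, Finset.mul_sum, ← Finset.sum_sub_distrib]
  refine sum_mem fun r hr => ?_
  rw [mul_comm, X, monomial_mul, mul_one, symbolMap_monomial, symbolMap_monomial, del_mul_smul,
    delPow_add_single, add_sub_cancel_left]
  refine Submodule.smul_mem _ _ (delPow_mem_opsLT ?_)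
  have hr' : r.degree = d := (hD.1.degree_eq_sum_deg_support hr).symm
  omega

theorem del_pow_mul (i : Fin n) (k : ℕ) (hD : HasPrincipalSymbol d D p) :
    HasPrincipalSymbol (d + k) (del F i ^ k * D) (X i ^ k * p) := by
  induction k with
  | zero => simpa using hD
  | succ k ih =>
    rw [pow_succ', mul_assoc, pow_succ', mul_assoc]
    exact ih.del_mul i

theorem delPow_mul (r : Fin n →₀ ℕ) (hD : HasPrincipalSymbol d D p) :
    HasPrincipalSymbol (d + r.degree) (delPow F r * D) (MvPolynomial.monomial r 1 * p) := by
  induction r using Finsupp.induction₂ with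
  | zero => simpa [delPow_zero] using hD
  | add_single i b r _ _ ih =>
    convert ih.del_pow_mul i b using 1
    · simp [add_assoc]
    · rw [delPow_add_single_pow, mul_assoc]
    · rw [X_pow_eq_monomial, ← mul_assoc, monomial_mul, one_mul, add_comm]

/-- The summand `∂_i^k` has order one less than `q x_i ∂_i^{k+1}`, so only the latter reaches the
symbol; hence the index `k + 1` on `phi`. -/
theorem steenrodOp_mul (q : F) (k : ℕ) (hD : HasPrincipalSymbol d D p) :
    HasPrincipalSymbol (d + (k + 1)) (steenrodOp n q k * D)
      (algebraMap F (RatFun F n) q • (phi F n (k + 1) * p)) := by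
  rw [steenrodOp, Finset.sum_mul, phi, Finset.sum_mul, Finset.smul_sum]
  refine sum _ _ _ fun i _ => ?_
  rw [add_mul, smul_mul_end]
  refine add_mem_opsLT ?_ (hD.del_pow_mul i k).mem_opsLT
  rw [mul_assoc, ← smul_eq_C_mul, smul_smul]
  exact (hD.del_pow_mul i (k + 1)).smul _

theorem steenrodOp_pow_mul (q : F) (k m : ℕ) (hD : HasPrincipalSymbol d D p) :
    HasPrincipalSymbol (d + m * (k + 1)) (steenrodOp n q k ^ m * D)
      (algebraMap F (RatFun F n) (q ^ m) • (phi F n (k + 1) ^ m * p)) := by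
  induction m with
  | zero => simpa using hD
  | succ m ih =>
    have h := ih.steenrodOp_mul q k
    convert h using 1
    · ring
    · rw [pow_succ', mul_assoc]
    · rw [mul_smul_comm, smul_smul, ← map_mul, pow_succ', pow_succ', mul_assoc]

end HasPrincipalSymbol

/-- Stated for an arbitrary list so that the ordered product of operators can be built up one left
factor at a time. -/
theorem HasPrincipalSymbol.steenrodList_mul {d : ℕ} {D : Module.End F (RatFun F n)}
    {p : MvPolynomial (Fin n) (RatFun F n)} (q : F) (r : Fin n → ℕ) (l : List (Fin n))
    (hD : HasPrincipalSymbol d D p) :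
    HasPrincipalSymbol (d + (l.map fun k : Fin n => r k * ((k : ℕ) + 2)).sum)
      ((l.map fun k : Fin n => steenrodOp n q (k + 1) ^ r k).prod * D)
      (algebraMap F (RatFun F n) (q ^ (l.map r).sum) •
        ((l.map fun k : Fin n => phi F n ((k : ℕ) + 2) ^ r k).prod * p)) := by
  induction l with
  | nil => simpa using hD
  | cons k l ih =>
    convert ih.steenrodOp_pow_mul q (k + 1) (r k) using 1
    · simp only [List.map_cons, List.sum_cons]
      ring
    · rw [List.map_cons, List.prod_cons, mul_assoc]
    · simp only [List.map_cons, List.sum_cons, List.prod_cons]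
      rw [mul_smul_comm, smul_smul, ← map_mul, pow_add, mul_assoc]

theorem hasPrincipalSymbol_delPow_mul_steenrodMonomial (q : F) (m : Fin n →₀ ℕ) (r : Fin n → ℕ) :
    HasPrincipalSymbol (∑ k : Fin n, r k * ((k : ℕ) + 2) + m.degree)
      (delPow F m * steenrodMonomial q r)
      (algebraMap F (RatFun F n) (q ^ ∑ k, r k) • symbolProd F m r) := by
  have h1 : HasPrincipalSymbol (F := F) (n := n) 0 1 1 := by
    simpa [delPow_zero] using HasPrincipalSymbol.monomial (F := F) (0 : Fin n →₀ ℕ)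
  have h := (h1.steenrodList_mul q r (List.finRange n)).delPow_mul m
  convert h using 1
  · rw [Fin.sum_univ_def, zero_add]
  · rw [mul_one, steenrodMonomial, List.ofFn_eq_map]
  · rw [mul_one, mul_smul_comm, symbolProd, Fin.prod_univ_def, Fin.sum_univ_def]

/-! ### Expansion of operators by induction on the order. -/

/-- The span of the operators `ξ^{u i}(∂) D_{1;q}^{r_1} ⋯ D_{n;q}^{r_n}` of order less than `d`. -/
def steenrodSpanLT {ι : Type*} (q : F) (u : ι → Fin n →₀ ℕ) (d : ℕ) :
    Submodule (RatFun F n) (Module.End F (RatFun F n)) :=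
  Submodule.span (RatFun F n) {T | ∃ (i : ι) (r : Fin n → ℕ),
    ∑ k : Fin n, r k * ((k : ℕ) + 2) + (u i).degree < d ∧ T = delPow F (u i) * steenrodMonomial q r}

theorem steenrodSpanLT_mono {ι : Type*} (q : F) (u : ι → Fin n →₀ ℕ) {d e : ℕ} (h : d ≤ e) :
    steenrodSpanLT q u d ≤ steenrodSpanLT q u e := by
  refine Submodule.span_mono ?_
  rintro _ ⟨i, r, hr, rfl⟩
  exact ⟨i, r, hr.trans_le h, rfl⟩

/-- Every homogeneous polynomial of degree `d` is the principal symbol of a combination of the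
operators `ξ^{u i}(∂) D_{1;q}^{r_1} ⋯ D_{n;q}^{r_n}` of order at most `d`. -/
theorem exists_hasPrincipalSymbol {ι : Type*} [Finite ι] {q : F} (hq : q ≠ 0)
    {u : ι → Fin n →₀ ℕ}
    (hu : Submodule.span (RatFun F n)
      (Set.range fun i => Ideal.Quotient.mk (Phi F n 2) (monomial (u i) 1)) = ⊤)
    {d : ℕ} {p : MvPolynomial (Fin n) (RatFun F n)} (hp : p.IsHomogeneous d) :
    ∃ T ∈ steenrodSpanLT q u (d + 1), HasPrincipalSymbol d T p := by
  have h := mem_span_symbolProd hu d p hp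
  clear hp
  induction h using Submodule.span_induction with
  | mem p hp =>
    obtain ⟨i, r, hr, rfl⟩ := hp
    have hq' : algebraMap F (RatFun F n) (q ^ ∑ k, r k) ≠ 0 :=
      (map_ne_zero_iff _ (algebraMap F (RatFun F n)).injective).mpr (pow_ne_zero _ hq)
    have h := hasPrincipalSymbol_delPow_mul_steenrodMonomial q (u i) r
    rw [hr] at h
    -- Dividing by `q^{|r|}` normalizes the symbol to the product itself; this is where `q ≠ 0`
    -- enters.
    refine ⟨(algebraMap F (RatFun F n) (q ^ ∑ k, r k))⁻¹ • (delPow F (u i) * steenrodMonomial q r),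
      Submodule.smul_mem _ _ (Submodule.subset_span ⟨i, r, by omega, rfl⟩), ?_⟩
    simpa only [smul_smul, inv_mul_cancel₀ hq', one_smul] using
      h.smul (algebraMap F (RatFun F n) (q ^ ∑ k, r k))⁻¹
  | zero => exact ⟨0, zero_mem _, HasPrincipalSymbol.zero d⟩
  | add p s _ _ hp hs =>
    obtain ⟨T, hT, hTp⟩ := hp
    obtain ⟨S, hS, hSs⟩ := hs
    exact ⟨T + S, add_mem hT hS, hTp.add hSs⟩
  | smul a p _ hp =>
    obtain ⟨T, hT, hTp⟩ := hp
    exact ⟨a • T, Submodule.smul_mem _ _ hT, hTp.smul a⟩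

/-- For `|m| = d`, some `T` in the span has the same principal symbol as `∂^m`. The difference `T -
∂^m` has order less than `d` and is in the span by induction. -/
theorem opsLT_le_steenrodSpanLT {ι : Type*} [Finite ι] {q : F} (hq : q ≠ 0)
    {u : ι → Fin n →₀ ℕ}
    (hu : Submodule.span (RatFun F n)
      (Set.range fun i => Ideal.Quotient.mk (Phi F n 2) (monomial (u i) 1)) = ⊤) (d : ℕ) :
    opsLT F n d ≤ steenrodSpanLT q u d := by
  induction d with
  | zero => simp [opsLT]
  | succ d ih =>
    refine Submodule.span_le.mpr ?_
    rintro _ ⟨m, hm, rfl⟩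
    rcases (Nat.lt_succ_iff.mp hm).lt_or_eq with h | h
    · exact steenrodSpanLT_mono q u d.le_succ (ih (delPow_mem_opsLT h))
    · obtain ⟨T, hT, hTm⟩ := exists_hasPrincipalSymbol hq hu (isHomogeneous_monomial (1 : RatFun F n) h)
      have h2 := steenrodSpanLT_mono q u d.le_succ (ih hTm.2)
      rw [symbolMap_monomial, one_smul] at h2
      have h3 := sub_mem hT h2
      rwa [sub_sub_cancel] at h3

theorem opOf_mem_opsLT {p : MvPolynomial (Fin n) (RatFun F n)} {d : ℕ}
    (hp : ∀ r, p.coeff r ≠ 0 → r.degree ≤ d) : opOf p ∈ opsLT F n (d + 1) :=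
  sum_mem fun r hr => Submodule.smul_mem _ _
    (delPow_mem_opsLT (Nat.lt_succ_of_le (hp r (mem_support_iff.mp hr))))

theorem exists_coeff_of_mem_steenrodSpanLT {ι : Type*} [Fintype ι] {q : F} {u : ι → Fin n →₀ ℕ}
    {d : ℕ} {D : Module.End F (RatFun F n)} (hD : D ∈ steenrodSpanLT q u (d + 1)) :
    ∃ a : ι → (Fin n → ℕ) → RatFun F n, D = ∑ i, ∑ r ∈ expSet n d (u i).degree,
      a i r • (delPow F (u i) * steenrodMonomial q r) := by
  classical
  induction hD using Submodule.span_induction with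
  | mem D hD =>
    obtain ⟨i, r, hr, rfl⟩ := hD
    refine ⟨fun j s => if j = i ∧ s = r then 1 else 0, ?_⟩
    rw [Finset.sum_eq_single i, Finset.sum_eq_single r]
    · simp
    · intro s _ hs
      simp [hs]
    · intro h
      refine absurd (mem_expSet.mpr ?_) h
      omega
    · intro j _ hj
      simp [hj]
    · simp
  | zero => exact ⟨0, by simp⟩
  | add D E _ _ hD hE =>
    obtain ⟨a, rfl⟩ := hD
    obtain ⟨b, rfl⟩ := hE
    refine ⟨a + b, ?_⟩
    simp only [Pi.add_apply, add_smul, Finset.sum_add_distrib]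
  | smul c D _ hD =>
    obtain ⟨a, rfl⟩ := hD
    refine ⟨fun i r => c * a i r, ?_⟩
    simp only [Finset.smul_sum, mul_smul]

end Steenrod

end

theorem mainTheorem9 {F : Type*} [Field F] (n : ℕ) (q : F) (hq : q ≠ 0) :
    (∃ u : Fin (n + 1).factorial → Fin n →₀ ℕ, Steenrod.IsMonomialBasis F 2 u) ∧
    ∀ u : Fin (n + 1).factorial → Fin n →₀ ℕ, Steenrod.IsMonomialBasis F 2 u →
      ∀ (d : ℕ) (D : Module.End F (Steenrod.RatFun F n)), Steenrod.IsDiffOpOfOrder D d →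
        ∃ a : Fin (n + 1).factorial → (Fin n → ℕ) → Steenrod.RatFun F n,
          D = ∑ i, ∑ r ∈ Steenrod.expSet n d (u i).degree,
            a i r • (Steenrod.delPow F (u i) * Steenrod.steenrodMonomial q r) := by
  refine ⟨Steenrod.exists_isMonomialBasis F n, fun u hu d D hD => ?_⟩
  obtain ⟨p, rfl, hp, -⟩ := hD
  exact Steenrod.exists_coeff_of_mem_steenrodSpanLT
    (Steenrod.opsLT_le_steenrodSpanLT hq hu.2 _ (Steenrod.opOf_mem_opsLT hp))
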